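/- Let $k$ be a commutative ring and let $\mathcal{T}$ be a class of finite groups closed under taking subquotients (that is, if $G\in\mathcal{T}$, $A\trianglelefteq B\leq G$ and $H\cong B/A$, then $H\in\mathcal{T}$). For finite groups $G,H$, let $B(H,G)$ be the Burnside group of finite $(H,G)$-bisets (sets with commuting left $H$-action and right $G$-action), i.e. the free abelian group on isomorphism classes of finite $(H,G)$-bisets modulo the relations $[X\sqcup Y]=[X]+[Y]$, and let $kB(H,G)=k\otimes_{\mathbb{Z}}B(H,G)$. Let $k\mathcal{T}$ be the category whose objects are the groups in $\mathcal{T}$, with $\mathrm{Hom}_{k\mathcal{T}}(G,H)=kB(H,G)$, with composition the $k$-bilinear extension of $[V]\circ[U]=[V\times_H U]$, where $V\times_HU=(V\times U)/H$ for a $(K,H)$-biset $V$ and an $(H,G)$-biset $U$, and with identity of $G$ the class of the $(G,G)$-biset $G$. Let $\mathcal{F}_{\mathcal{T},k}$ be the category of $k$-linear functors from $k\mathcal{T}$ to $k$-modules, with natural transformations as morphisms. For $R\in\mathcal{T}$, let $kB_R=\mathrm{Hom}_{k\mathcal{T}}(R,-)\in\mathcal{F}_{\mathcal{T},k}$, so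 that $kB_R(H)=kB(H,R)$. Let $F\in\mathcal{F}_{\mathcal{T},k}$. An element of $F$ is a pair $(R,v)$ with $R\in\mathcal{T}$ and $v\in F(R)$; $F$ is finitely generated if there is a finite set $\mathcal{G}$ of elements of $F$ such that the intersection of all subfunctors $L$ of $F$ with $v\in L(R)$ for all $(R,v)\in\mathcal{G}$ is equal to $F$. For $H\in\mathcal{T}$, the residue of $F$ at $H$ is the $k$-module $$\overline{F}(H)=F(H)\Big/\sum_{\substack{T\in\mathcal{T},\ |T|<|H|\\ \alpha\in kB(H,T)}}F(\alpha)\big(F(T)\big).$$ Then the following conditions are equivalent: 1. The functor $F$ is finitely generated. 2. There exist a finite family $\mathcal{E}$ of groups in $\mathcal{T}$ (repetitions allowed) and an epimorphism $\bigoplus_{R\in\mathcal{E}}kB_R\to F$ in $\mathcal{F}_{\mathcal{T},k}$. 3. For every $H\in\mathcal{T}$, the $k$-module $\overline{F}(H)$ is finitely generated, and there exists $n\in\mathbb{N}$ such that $\overline{F}(H)=\{0\}$ for every $H\in\mathcal{T}$ with $|H|>n$. -/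

import Mathlib

open CategoryTheory MulOpposite
open scoped TensorProduct DirectSum

universe u v

/-! ### Finite `A`-sets and the Burnside group -/

/-- A finite `A`-set. The underlying set is taken to be a standard finite set `Fin n`; every finite
`A`-set is isomorphic to one of these (see `GSetClass.of`). -/
structure FinGSet (A : Type u) [Group A] : Type u where
  card : ℕ
  action : MulAction A (Fin card)

instance (A : Type u) [Group A] (X : FinGSet A) : MulAction A (Fin X.card) := X.action

/-- Two `A`-sets are isomorphic when there is an `A`-equivariant bijection between them. -/
def GSetIso (A : Type*) [Group A] (X Y : Type*) [MulAction A X] [MulAction A Y] : Prop :=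
  ∃ e : X ≃ Y, ∀ (a : A) (x : X), e (a • x) = a • e x

namespace GSetIso

variable {A : Type*} [Group A] {X Y Z X' Y' : Type*} [MulAction A X] [MulAction A Y]
  [MulAction A Z] [MulAction A X'] [MulAction A Y']

theorem refl (X : Type*) [MulAction A X] : GSetIso A X X := ⟨Equiv.refl X, fun _ _ => rfl⟩

theorem symm (h : GSetIso A X Y) : GSetIso A Y X := by
  obtain ⟨e, he⟩ := h
  exact ⟨e.symm, fun a y => by rw [Equiv.symm_apply_eq, he, Equiv.apply_symm_apply]⟩

theorem trans (h : GSetIso A X Y) (h' : GSetIso A Y Z) : GSetIso A X Z := by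
  obtain ⟨e, he⟩ := h
  obtain ⟨e', he'⟩ := h'
  exact ⟨e.trans e', fun a x => by simp [he, he']⟩

theorem sum (h : GSetIso A X X') (h' : GSetIso A Y Y') : GSetIso A (X ⊕ Y) (X' ⊕ Y') := by
  obtain ⟨e, he⟩ := h
  obtain ⟨e', he'⟩ := h'
  refine ⟨Equiv.sumCongr e e', ?_⟩
  rintro a (x | y)
  · simp [he]
  · simp [he']

end GSetIso

/-- Isomorphism of finite `A`-sets, as a setoid. -/
def FinGSet.setoid (A : Type u) [Group A] : Setoid (FinGSet A) where
  r X Y := GSetIso A (Fin X.card) (Fin Y.card)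
  iseqv := ⟨fun _ => GSetIso.refl _, fun h => h.symm, fun h h' => h.trans h'⟩

/-- The set of isomorphism classes of finite `A`-sets. -/
def GSetClass (A : Type u) [Group A] : Type u := Quotient (FinGSet.setoid A)

/-- The finite `A`-set on `Fin n` obtained by numbering the elements of a finite `A`-set `X`. -/
noncomputable def FinGSet.ofFinite (A : Type u) [Group A] (X : Type*) [Finite X] [MulAction A X] :
    FinGSet A where
  card := Nat.card X
  action := (Finite.equivFin X).symm.mulAction A

theorem FinGSet.ofFinite_iso (A : Type u) [Group A] (X : Type*) [Finite X] [MulAction A X] :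
    GSetIso A X (Fin (FinGSet.ofFinite A X).card) := by
  refine ⟨Finite.equivFin X, fun a x => ?_⟩
  change _ = (Finite.equivFin X).symm.symm (a • (Finite.equivFin X).symm (Finite.equivFin X x))
  rw [Equiv.symm_apply_apply]
  rfl

/-- The isomorphism class of an arbitrary finite `A`-set. -/
noncomputable def GSetClass.of (A : Type u) [Group A] (X : Type*) [Finite X] [MulAction A X] :
    GSetClass A :=
  Quotient.mk (FinGSet.setoid A) (FinGSet.ofFinite A X)

theorem GSetClass.of_eq_of_iff {A : Type u} [Group A] {X Y : Type*} [Finite X] [Finite Y]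
    [MulAction A X] [MulAction A Y] : GSetClass.of A X = GSetClass.of A Y ↔ GSetIso A X Y := by
  refine (Quotient.eq (r := FinGSet.setoid A)).trans ?_
  exact ⟨fun h => ((FinGSet.ofFinite_iso A X).trans h).trans (FinGSet.ofFinite_iso A Y).symm,
    fun h => ((FinGSet.ofFinite_iso A X).symm.trans h).trans (FinGSet.ofFinite_iso A Y)⟩

theorem GSetClass.exists_rep {A : Type u} [Group A] (c : GSetClass A) :
    ∃ X : FinGSet A, c = GSetClass.of A (Fin X.card) := by
  induction c using Quotient.inductionOn with
  | h X => exact ⟨X, Quotient.sound (s := FinGSet.setoid A) (FinGSet.ofFinite_iso A _)⟩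

/-- The subgroup of relations `[X ⊔ Y] - [X] - [Y]`. -/
noncomputable def burnsideRel (A : Type u) [Group A] : AddSubgroup (FreeAbelianGroup (GSetClass A)) :=
  AddSubgroup.closure {r | ∃ X Y : FinGSet A,
    r = FreeAbelianGroup.of (GSetClass.of A (Fin X.card ⊕ Fin Y.card))
      - FreeAbelianGroup.of (GSetClass.of A (Fin X.card))
      - FreeAbelianGroup.of (GSetClass.of A (Fin Y.card))}

/-- The Burnside group `B(A)`: the free abelian group on the isomorphism classes of finite `A`-sets
modulo the relations `[X ⊔ Y] = [X] + [Y]`. -/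
abbrev BurnsideGroup (A : Type u) [Group A] : Type u :=
  FreeAbelianGroup (GSetClass A) ⧸ burnsideRel A

namespace BurnsideGroup

variable {A : Type u} [Group A]

/-- The image in `B(A)` of an isomorphism class. -/
noncomputable def ofClass (c : GSetClass A) : BurnsideGroup A :=
  QuotientAddGroup.mk (FreeAbelianGroup.of c)

/-- The class `[X]` in `B(A)` of a finite `A`-set `X`. -/
noncomputable def of (A : Type u) [Group A] (X : Type*) [Finite X] [MulAction A X] :
    BurnsideGroup A :=
  ofClass (GSetClass.of A X)

theorem of_eq {X Y : Type*} [Finite X] [Finite Y] [MulAction A X] [MulAction A Y]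
    (h : GSetIso A X Y) : of A X = of A Y := by
  unfold of
  rw [GSetClass.of_eq_of_iff.2 h]

theorem of_sum (X Y : Type*) [Finite X] [Finite Y] [MulAction A X] [MulAction A Y] :
    of A (X ⊕ Y) = of A X + of A Y := by
  have hX := FinGSet.ofFinite_iso A X
  have hY := FinGSet.ofFinite_iso A Y
  rw [of_eq hX, of_eq hY, of_eq (hX.sum hY), ← sub_eq_zero, ← sub_sub]
  exact (QuotientAddGroup.eq_zero_iff _).2
    (AddSubgroup.subset_closure ⟨FinGSet.ofFinite A X, FinGSet.ofFinite A Y, rfl⟩)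

/-- The universal property of `B(A)`. -/
noncomputable def lift {M : Type*} [AddCommGroup M] (f : GSetClass A → M)
    (hf : ∀ X Y : FinGSet A, f (GSetClass.of A (Fin X.card ⊕ Fin Y.card)) =
      f (GSetClass.of A (Fin X.card)) + f (GSetClass.of A (Fin Y.card))) :
    BurnsideGroup A →+ M :=
  QuotientAddGroup.lift (burnsideRel A) (FreeAbelianGroup.lift f) (by
    unfold burnsideRel
    rw [AddSubgroup.closure_le]
    rintro _ ⟨X, Y, rfl⟩
    simp [hf])

@[simp]
theorem lift_ofClass {M : Type*} [AddCommGroup M] (f : GSetClass A → M) (hf) (c : GSetClass A) :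
    lift f hf (ofClass c) = f c := by
  simp only [lift, ofClass, QuotientAddGroup.lift_mk, FreeAbelianGroup.lift_apply_of]

theorem hom_ext {M : Type*} [AddCommGroup M] {f g : BurnsideGroup A →+ M}
    (h : ∀ X : FinGSet A, f (of A (Fin X.card)) = g (of A (Fin X.card))) : f = g := by
  apply QuotientAddGroup.addMonoidHom_ext
  ext c
  obtain ⟨X, rfl⟩ := c.exists_rep
  exact h X

theorem induction {p : BurnsideGroup A → Prop}
    (of : ∀ X : FinGSet A, p (of A (Fin X.card))) (add : ∀ x y, p x → p y → p (x + y))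
    (neg : ∀ x, p x → p (-x)) (x : BurnsideGroup A) : p x := by
  obtain ⟨x, rfl⟩ := QuotientAddGroup.mk_surjective x
  have key : ∀ c : GSetClass A, p (ofClass c) := fun c => by
    obtain ⟨X, rfl⟩ := c.exists_rep
    exact of X
  induction x using FreeAbelianGroup.induction_on with
  | zero =>
    have h := of ⟨1, { smul := fun _ x => x, one_smul := fun _ => rfl, mul_smul := fun _ _ _ => rfl }⟩
    simpa using add _ _ h (neg _ h)
  | of c => exact key c
  | neg c _ => exact neg _ (key c)
  | add x y hx hy => exact add _ _ hx hy

end BurnsideGroup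

/-! ### Bisets and their composition

An `(H, G)`-biset is a set with an action of `H × Gᵐᵒᵖ`: the element `h` acts on the left as
`(h, 1)`, and `g` acts on the right as `(1, op g)`. -/

section Tensor

variable (K H G : Type*) [Group K] [Group H] [Group G] (V U : Type*)
  [MulAction (K × Hᵐᵒᵖ) V] [MulAction (H × Gᵐᵒᵖ) U]

/-- The relation on `V × U` of being in the same orbit of `H`, for the right action
`(v, u) h = (v h, h⁻¹ u)`. -/
def bisetSetoid : Setoid (V × U) where
  r p q := ∃ h : H, q = (((1, op h) : K × Hᵐᵒᵖ) • p.1, ((h⁻¹, 1) : H × Gᵐᵒᵖ) • p.2)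
  iseqv := by
    refine ⟨fun p => ⟨1, ?_⟩, ?_, ?_⟩
    · rw [op_one, inv_one, Prod.mk_one_one, Prod.mk_one_one, one_smul, one_smul]
    · rintro p _ ⟨h, rfl⟩
      exact ⟨h⁻¹, by simp [smul_smul, ← Prod.one_eq_mk]⟩
    · rintro p _ _ ⟨h, rfl⟩ ⟨h', rfl⟩
      exact ⟨h * h', by simp [smul_smul]⟩

/-- The composition `V ×_H U = (V × U) / H` of a `(K, H)`-biset `V` and an `(H, G)`-biset `U`. -/
def BisetTensor : Type _ := Quotient (bisetSetoid K H G V U)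

namespace BisetTensor

variable {V U}

/-- The class of `(v, u)` in `V ×_H U`. -/
def mk (v : V) (u : U) : BisetTensor K H G V U := Quotient.mk (bisetSetoid K H G V U) (v, u)

theorem mk_eq_mk_iff {v v' : V} {u u' : U} : mk K H G v u = mk K H G v' u' ↔
    ∃ h : H, v' = ((1, op h) : K × Hᵐᵒᵖ) • v ∧ u' = ((h⁻¹, 1) : H × Gᵐᵒᵖ) • u := by
  refine (Quotient.eq (r := bisetSetoid K H G V U)).trans ?_
  exact exists_congr fun h => Prod.mk_inj

theorem mk_balanced (v : V) (h : H) (u : U) :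
    mk K H G (((1, op h) : K × Hᵐᵒᵖ) • v) u = mk K H G v (((h, 1) : H × Gᵐᵒᵖ) • u) :=
  (mk_eq_mk_iff K H G).2 ⟨h⁻¹, by simp [smul_smul, ← Prod.one_eq_mk], by simp⟩

variable {K H G} in
/-- A balanced map out of `V × U` factors through `V ×_H U`. -/
def lift {X : Type*} (f : V → U → X) (hf : ∀ (v : V) (h : H) (u : U),
    f (((1, op h) : K × Hᵐᵒᵖ) • v) u = f v (((h, 1) : H × Gᵐᵒᵖ) • u)) :
    BisetTensor K H G V U → X :=
  Quotient.lift (fun p => f p.1 p.2) (by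
    rintro p _ ⟨h, rfl⟩
    simp [hf, smul_smul, ← Prod.one_eq_mk])

variable {K H G} in
theorem ind {p : BisetTensor K H G V U → Prop} (h : ∀ v u, p (mk K H G v u)) (x) : p x :=
  Quotient.inductionOn x fun ⟨v, u⟩ => h v u

instance [Finite V] [Finite U] : Finite (BisetTensor K H G V U) :=
  inferInstanceAs (Finite (Quotient _))

/-- The `(K, G)`-biset structure on `V ×_H U`: `k [v, u] g = [k v, u g]`. -/
instance : MulAction (K × Gᵐᵒᵖ) (BisetTensor K H G V U) where
  smul a := Quotient.map (fun p => (((a.1, 1) : K × Hᵐᵒᵖ) • p.1, ((1, a.2) : H × Gᵐᵒᵖ) • p.2)) (by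
    rintro p _ ⟨h, rfl⟩
    exact ⟨h, by simp [smul_smul]⟩)
  one_smul := ind fun v u => by
    change mk K H G _ _ = _
    simp [← Prod.one_eq_mk]
  mul_smul a b := ind fun v u => by
    change mk K H G _ _ = mk K H G _ _
    simp [smul_smul]

theorem smul_mk (a : K × Gᵐᵒᵖ) (v : V) (u : U) :
    a • mk K H G v u = mk K H G (((a.1, 1) : K × Hᵐᵒᵖ) • v) (((1, a.2) : H × Gᵐᵒᵖ) • u) := rfl

end BisetTensor

/-- The identity `(G, G)`-biset: the set `G` with left and right multiplication. -/
@[ext]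
structure IdBiset (G : Type*) where
  val : G

instance (G : Type*) [Finite G] : Finite (IdBiset G) :=
  Finite.of_injective IdBiset.val fun _ _ => IdBiset.ext

instance (G : Type*) [Group G] : MulAction (G × Gᵐᵒᵖ) (IdBiset G) where
  smul a x := ⟨a.1 * x.val * a.2.unop⟩
  one_smul x := IdBiset.ext (show 1 * x.val * 1 = x.val by simp)
  mul_smul a b x := IdBiset.ext (show a.1 * b.1 * x.val * (b.2.unop * a.2.unop) =
    a.1 * (b.1 * x.val * b.2.unop) * a.2.unop by simp [mul_assoc])

@[simp]
theorem IdBiset.smul_val {G : Type*} [Group G] (a : G × Gᵐᵒᵖ) (x : IdBiset G) :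
    (a • x).val = a.1 * x.val * a.2.unop := rfl

end Tensor

section TensorIso

variable {L K H G : Type*} [Group L] [Group K] [Group H] [Group G] {V V' U U' W : Type*}
  [MulAction (K × Hᵐᵒᵖ) V] [MulAction (K × Hᵐᵒᵖ) V'] [MulAction (H × Gᵐᵒᵖ) U]
  [MulAction (H × Gᵐᵒᵖ) U'] [MulAction (L × Kᵐᵒᵖ) W]

theorem BisetTensor.iso_congr (hV : GSetIso (K × Hᵐᵒᵖ) V V') (hU : GSetIso (H × Gᵐᵒᵖ) U U') :
    GSetIso (K × Gᵐᵒᵖ) (BisetTensor K H G V U) (BisetTensor K H G V' U') := by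
  obtain ⟨e, he⟩ := hV
  obtain ⟨f, hf⟩ := hU
  refine ⟨Quotient.congr (Equiv.prodCongr e f) ?_, fun a => ?_⟩
  · rintro ⟨v, u⟩ ⟨v', u'⟩
    change (∃ h : H, _) ↔ (∃ h : H, _)
    refine exists_congr fun h => ?_
    simp [Prod.ext_iff, ← he, ← hf]
  · refine BisetTensor.ind fun v u => ?_
    change mk K H G (e _) (f _) = mk K H G (_ • e v) (_ • f u)
    rw [he, hf]

theorem BisetTensor.iso_sum_left : GSetIso (K × Gᵐᵒᵖ) (BisetTensor K H G (V ⊕ V') U)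
    (BisetTensor K H G V U ⊕ BisetTensor K H G V' U) := by
  refine ⟨⟨lift (fun x u => Sum.map (fun v => mk K H G v u) (fun v => mk K H G v u) x) ?_,
    Sum.elim (lift (fun v u => mk K H G (Sum.inl v) u) ?_)
      (lift (fun v u => mk K H G (Sum.inr v) u) ?_), ?_, ?_⟩, ?_⟩
  · rintro (v | v) h u
    · exact congrArg Sum.inl (mk_balanced K H G v h u)
    · exact congrArg Sum.inr (mk_balanced K H G v h u)
  · exact fun v h u => mk_balanced K H G (Sum.inl v : V ⊕ V') h u
  · exact fun v h u => mk_balanced K H G (Sum.inr v : V ⊕ V') h u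
  · refine BisetTensor.ind ?_
    rintro (v | v) u <;> rfl
  · rintro (x | x) <;> revert x <;> exact BisetTensor.ind fun v u => rfl
  · intro a
    refine BisetTensor.ind ?_
    rintro (v | v) u <;> rfl

theorem BisetTensor.iso_sum_right : GSetIso (K × Gᵐᵒᵖ) (BisetTensor K H G V (U ⊕ U'))
    (BisetTensor K H G V U ⊕ BisetTensor K H G V U') := by
  refine ⟨⟨lift (fun v x => Sum.map (fun u => mk K H G v u) (fun u => mk K H G v u) x) ?_,
    Sum.elim (lift (fun v u => mk K H G v (Sum.inl u)) ?_)
      (lift (fun v u => mk K H G v (Sum.inr u)) ?_), ?_, ?_⟩, ?_⟩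
  · rintro v h (u | u)
    · exact congrArg Sum.inl (mk_balanced K H G v h u)
    · exact congrArg Sum.inr (mk_balanced K H G v h u)
  · exact fun v h u => mk_balanced K H G v h (Sum.inl u : U ⊕ U')
  · exact fun v h u => mk_balanced K H G v h (Sum.inr u : U ⊕ U')
  · refine BisetTensor.ind ?_
    rintro v (u | u) <;> rfl
  · rintro (x | x) <;> revert x <;> exact BisetTensor.ind fun v u => rfl
  · intro a
    refine BisetTensor.ind ?_
    rintro v (u | u) <;> rfl

theorem BisetTensor.iso_assoc : GSetIso (L × Gᵐᵒᵖ)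
    (BisetTensor L H G (BisetTensor L K H W V) U)
    (BisetTensor L K G W (BisetTensor K H G V U)) := by
  refine ⟨⟨lift (fun x u => lift (fun w v => mk L K G w (mk K H G v u)) ?_ x) ?_,
    lift (fun w x => lift (fun v u => mk L H G (mk L K H w v) u) ?_ x) ?_, ?_, ?_⟩, ?_⟩
  · intro w k v
    refine (mk_balanced L K G w k (mk K H G v u)).trans ?_
    rw [smul_mk, Prod.mk_one_one, one_smul]
  · intro x h u
    revert x
    refine BisetTensor.ind fun w v => ?_
    change mk L K G (((1, 1) : L × Kᵐᵒᵖ) • w) (mk K H G (((1, op h) : K × Hᵐᵒᵖ) • v) u) =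
      mk L K G w (mk K H G v (((h, 1) : H × Gᵐᵒᵖ) • u))
    rw [Prod.mk_one_one, one_smul, mk_balanced]
  · intro v h u
    refine Eq.trans ?_ (mk_balanced L H G (mk L K H w v) h u)
    rw [smul_mk, Prod.mk_one_one, one_smul]
  · intro w k x
    revert x
    refine BisetTensor.ind fun v u => ?_
    change mk L H G (mk L K H (((1, op k) : L × Kᵐᵒᵖ) • w) v) u =
      mk L H G (mk L K H w (((k, 1) : K × Hᵐᵒᵖ) • v)) (((1, 1) : H × Gᵐᵒᵖ) • u)
    rw [Prod.mk_one_one, one_smul, mk_balanced]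
  · refine BisetTensor.ind fun x u => ?_
    revert x
    exact BisetTensor.ind fun w v => rfl
  · refine BisetTensor.ind fun w x => ?_
    revert x
    exact BisetTensor.ind fun v u => rfl
  · intro a
    refine BisetTensor.ind fun x u => ?_
    revert x
    refine BisetTensor.ind fun w v => ?_
    change mk L K G (((a.1, 1) : L × Kᵐᵒᵖ) • w)
        (mk K H G (((1, 1) : K × Hᵐᵒᵖ) • v) (((1, a.2) : H × Gᵐᵒᵖ) • u)) =
      mk L K G (((a.1, 1) : L × Kᵐᵒᵖ) • w)
        (mk K H G (((1, 1) : K × Hᵐᵒᵖ) • v) (((1, a.2) : H × Gᵐᵒᵖ) • u))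
    rfl

theorem BisetTensor.iso_id_left : GSetIso (H × Gᵐᵒᵖ) (BisetTensor H H G (IdBiset H) U) U := by
  refine ⟨⟨lift (fun h u => ((h.val, 1) : H × Gᵐᵒᵖ) • u) ?_, fun u => mk H H G ⟨1⟩ u, ?_, ?_⟩, ?_⟩
  · intro x h u
    simp [smul_smul]
  · refine BisetTensor.ind fun x u => ?_
    refine (mk_balanced H H G (⟨1⟩ : IdBiset H) x.val u).symm.trans ?_
    congr 1
    ext
    simp
  · intro u
    change ((1, 1) : H × Gᵐᵒᵖ) • u = u
    rw [Prod.mk_one_one, one_smul]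
  · intro a
    refine BisetTensor.ind fun x u => ?_
    change (((((a.1, 1) : H × Hᵐᵒᵖ) • x).val, 1) : H × Gᵐᵒᵖ) • ((1, a.2) : H × Gᵐᵒᵖ) • u =
      a • ((x.val, 1) : H × Gᵐᵒᵖ) • u
    rw [smul_smul, smul_smul]
    congr 1
    ext <;> simp

theorem BisetTensor.iso_id_right : GSetIso (K × Hᵐᵒᵖ) (BisetTensor K H H V (IdBiset H)) V := by
  refine ⟨⟨lift (fun v h => ((1, op h.val) : K × Hᵐᵒᵖ) • v) ?_, fun v => mk K H H v ⟨1⟩, ?_, ?_⟩,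
    ?_⟩
  · intro v h x
    simp [smul_smul]
  · refine BisetTensor.ind fun v x => ?_
    refine (mk_balanced K H H v x.val (⟨1⟩ : IdBiset H)).trans ?_
    congr 1
    ext
    simp
  · intro v
    change ((1, op 1) : K × Hᵐᵒᵖ) • v = v
    rw [op_one, Prod.mk_one_one, one_smul]
  · intro a
    refine BisetTensor.ind fun v x => ?_
    change ((1, op (((1, a.2) : H × Hᵐᵒᵖ) • x).val) : K × Hᵐᵒᵖ) • ((a.1, 1) : K × Hᵐᵒᵖ) • v =
      a • ((1, op x.val) : K × Hᵐᵒᵖ) • v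
    rw [smul_smul, smul_smul]
    congr 1
    ext <;> simp

end TensorIso

/-! ### The biset category -/

/-- `B(H, G) = B(H × Gᵒᵖ)`, the Burnside group of finite `(H, G)`-bisets. -/
abbrev BisetBurnside (H G : Type u) [Group H] [Group G] : Type u := BurnsideGroup (H × Gᵐᵒᵖ)

section Composition

variable (L K H G : Type u) [Group L] [Group K] [Group H] [Group G]

/-- The class of `V ×_H U`, as a function of the classes of `V` and `U`. -/
noncomputable def bisetCompClass (c : GSetClass (K × Hᵐᵒᵖ)) (d : GSetClass (H × Gᵐᵒᵖ)) :
    GSetClass (K × Gᵐᵒᵖ) :=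
  Quotient.liftOn₂ c d
    (fun V U => GSetClass.of (K × Gᵐᵒᵖ) (BisetTensor K H G (Fin V.card) (Fin U.card)))
    fun _ _ _ _ h h' => GSetClass.of_eq_of_iff.2 (BisetTensor.iso_congr h h')

theorem bisetCompClass_of (V U : Type*) [Finite V] [Finite U] [MulAction (K × Hᵐᵒᵖ) V]
    [MulAction (H × Gᵐᵒᵖ) U] :
    bisetCompClass K H G (GSetClass.of _ V) (GSetClass.of _ U) =
      GSetClass.of _ (BisetTensor K H G V U) :=
  GSetClass.of_eq_of_iff.2
    (BisetTensor.iso_congr (FinGSet.ofFinite_iso _ V).symm (FinGSet.ofFinite_iso _ U).symm)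

/-- The composition `B(K, H) × B(H, G) → B(K, G)`, the biadditive map sending `([V], [U])` to
`[V ×_H U]`. -/
noncomputable def bisetComp : BisetBurnside K H →+ BisetBurnside H G →+ BisetBurnside K G :=
  BurnsideGroup.lift
    (fun c => BurnsideGroup.lift (fun d => BurnsideGroup.ofClass (bisetCompClass K H G c d)) (by
      intro X Y
      obtain ⟨V, rfl⟩ := c.exists_rep
      simp only [bisetCompClass_of]
      exact (BurnsideGroup.of_eq BisetTensor.iso_sum_right).trans (BurnsideGroup.of_sum _ _)))
    (by
      intro X Y
      refine BurnsideGroup.hom_ext fun U => ?_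
      simp only [AddMonoidHom.add_apply, BurnsideGroup.of, BurnsideGroup.lift_ofClass,
        bisetCompClass_of]
      exact (BurnsideGroup.of_eq BisetTensor.iso_sum_left).trans (BurnsideGroup.of_sum _ _))

theorem bisetComp_of (V U : Type*) [Finite V] [Finite U] [MulAction (K × Hᵐᵒᵖ) V]
    [MulAction (H × Gᵐᵒᵖ) U] :
    bisetComp K H G (BurnsideGroup.of _ V) (BurnsideGroup.of _ U) =
      BurnsideGroup.of _ (BisetTensor K H G V U) := by
  simp only [bisetComp, BurnsideGroup.of, BurnsideGroup.lift_ofClass, bisetCompClass_of]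

/-- The identity of `G` in the biset category. -/
noncomputable def bisetId [Finite G] : BisetBurnside G G := BurnsideGroup.of _ (IdBiset G)

variable {L K H G}

theorem bisetComp_id_left [Finite H] (b : BisetBurnside H G) :
    bisetComp H H G (bisetId H) b = b := by
  refine DFunLike.congr_fun (f := bisetComp H H G (bisetId H)) (g := AddMonoidHom.id _)
    (BurnsideGroup.hom_ext fun U => ?_) b
  exact (bisetComp_of _ _ _ _ _).trans (BurnsideGroup.of_eq BisetTensor.iso_id_left)

theorem bisetComp_id_right [Finite H] (a : BisetBurnside K H) :
    bisetComp K H H a (bisetId H) = a := by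
  refine DFunLike.congr_fun (f := (bisetComp K H H).flip (bisetId H)) (g := AddMonoidHom.id _)
    (BurnsideGroup.hom_ext fun U => ?_) a
  exact (bisetComp_of _ _ _ _ _).trans (BurnsideGroup.of_eq BisetTensor.iso_id_right)

theorem bisetComp_assoc (a : BisetBurnside L K) (b : BisetBurnside K H) (c : BisetBurnside H G) :
    bisetComp L H G (bisetComp L K H a b) c = bisetComp L K G a (bisetComp K H G b c) := by
  induction a using BurnsideGroup.induction with
  | add x y hx hy => simp only [map_add, AddMonoidHom.add_apply, hx, hy]
  | neg x hx => simp only [map_neg, AddMonoidHom.neg_apply, hx]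
  | of W =>
  induction b using BurnsideGroup.induction with
  | add x y hx hy => simp only [map_add, AddMonoidHom.add_apply, hx, hy]
  | neg x hx => simp only [map_neg, AddMonoidHom.neg_apply, hx]
  | of V =>
  induction c using BurnsideGroup.induction with
  | add x y hx hy => simp only [map_add, hx, hy]
  | neg x hx => simp only [map_neg, hx]
  | of U =>
  simp only [bisetComp_of]
  exact BurnsideGroup.of_eq BisetTensor.iso_assoc

end Composition

/-- `kB(H, G) = k ⊗ B(H, G)`. -/
abbrev LinBisetBurnside (k : Type v) [CommRing k] (H G : Type u) [Group H] [Group G] :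
    Type (max u v) :=
  k ⊗[ℤ] BisetBurnside H G

section LinComposition

variable (k : Type v) [CommRing k] (L K H G : Type u) [Group L] [Group K] [Group H] [Group G]

/-- The `k`-bilinear extension of the composition of bisets. -/
noncomputable def linBisetComp : LinBisetBurnside k K H →ₗ[k] LinBisetBurnside k H G →ₗ[k]
    LinBisetBurnside k K G :=
  LinearMap.liftBaseChange k (AddMonoidHom.toIntLinearMap
    { toFun := fun a => (bisetComp K H G a).toIntLinearMap.baseChange k
      map_zero' := by ext; simp
      map_add' := fun a b => by ext; simp [TensorProduct.tmul_add] })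

@[simp]
theorem linBisetComp_tmul (r s : k) (a : BisetBurnside K H) (b : BisetBurnside H G) :
    linBisetComp k K H G (r ⊗ₜ a) (s ⊗ₜ b) = (r * s) ⊗ₜ bisetComp K H G a b := by
  simp [linBisetComp, TensorProduct.smul_tmul']

variable {k L K H G}

theorem linBisetComp_id_left [Finite H] (b : LinBisetBurnside k H G) :
    linBisetComp k H H G (1 ⊗ₜ bisetId H) b = b := by
  induction b using TensorProduct.induction_on with
  | zero => simp
  | tmul r b => simp [bisetComp_id_left]
  | add x y hx hy => rw [map_add, hx, hy]

theorem linBisetComp_id_right [Finite H] (a : LinBisetBurnside k K H) :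
    linBisetComp k K H H a (1 ⊗ₜ bisetId H) = a := by
  induction a using TensorProduct.induction_on with
  | zero => simp
  | tmul r b => simp [bisetComp_id_right]
  | add x y hx hy => rw [map_add, LinearMap.add_apply, hx, hy]

theorem linBisetComp_assoc (a : LinBisetBurnside k L K) (b : LinBisetBurnside k K H)
    (c : LinBisetBurnside k H G) :
    linBisetComp k L H G (linBisetComp k L K H a b) c =
      linBisetComp k L K G a (linBisetComp k K H G b c) := by
  induction a using TensorProduct.induction_on with
  | zero => simp
  | add x y hx hy => simp only [map_add, LinearMap.add_apply, hx, hy]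
  | tmul r a =>
  induction b using TensorProduct.induction_on with
  | zero => simp
  | add x y hx hy => simp only [map_add, LinearMap.add_apply, hx, hy]
  | tmul s b =>
  induction c using TensorProduct.induction_on with
  | zero => simp
  | add x y hx hy => simp only [map_add, hx, hy]
  | tmul t c => simp only [linBisetComp_tmul, bisetComp_assoc, mul_assoc]

end LinComposition

/-- The objects of the `k`-linear biset category `k𝒞`: all finite groups. -/
structure BisetCat (k : Type v) [CommRing k] : Type (u + 1) where
  grp : FiniteGrp.{u}

/-- The category `k𝒞`: a morphism from `G` to `H` is an element of `kB(H, G)`, and the composition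
of `α : G ⟶ H` and `β : H ⟶ K` is `β ×_H α`. -/
noncomputable instance (k : Type v) [CommRing k] : Category.{max u v} (BisetCat.{u} k) where
  Hom G H := LinBisetBurnside k H.grp G.grp
  id G := 1 ⊗ₜ bisetId G.grp
  comp {G H K} α β := linBisetComp k K.grp H.grp G.grp β α
  id_comp α := linBisetComp_id_right α
  comp_id α := linBisetComp_id_left α
  assoc α β γ := (linBisetComp_assoc γ β α).symm

noncomputable instance (k : Type v) [CommRing k] : Preadditive (BisetCat.{u} k) where
  homGroup G H := inferInstanceAs (AddCommGroup (LinBisetBurnside k H.grp G.grp))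
  add_comp _ _ _ f f' g := (linBisetComp _ _ _ _ g).map_add f f'
  comp_add _ _ _ f g g' := DFunLike.congr_fun ((linBisetComp _ _ _ _).map_add g g') f

noncomputable instance (k : Type v) [CommRing k] : Linear k (BisetCat.{u} k) where
  homModule G H := inferInstanceAs (Module k (LinBisetBurnside k H.grp G.grp))
  smul_comp _ _ _ r f g := (linBisetComp _ _ _ _ g).map_smul r f
  comp_smul _ _ _ f r g := DFunLike.congr_fun ((linBisetComp _ _ _ _).map_smul r g) f

/-! ### Biset functors on a class of finite groups -/

/-- `H` is a subquotient of `G` if it is isomorphic to `B / A` for some subgroups `A ⊴ B ≤ G`. -/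
def IsSubquotient (H G : Type*) [Group H] [Group G] : Prop :=
  ∃ (B : Subgroup G) (A : Subgroup B) (_ : A.Normal), Nonempty (B ⧸ A ≃* H)

/-- The class `𝒯` of finite groups is closed under taking subquotients. -/
def ClosedUnderSubquotients (𝒯 : FiniteGrp.{u} → Prop) : Prop :=
  ∀ G H : FiniteGrp.{u}, 𝒯 G → IsSubquotient H G → 𝒯 H

/-- The full subcategory `k𝒯` of `k𝒞` on the groups in `𝒯`. -/
abbrev BisetCatOn (k : Type v) [CommRing k] (𝒯 : FiniteGrp.{u} → Prop) : Type (u + 1) :=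
  ObjectProperty.FullSubcategory fun G : BisetCat.{u} k => 𝒯 G.grp

/-- The finite group underlying an object of `k𝒯`. -/
abbrev BisetCatOn.group {k : Type v} [CommRing k] {𝒯 : FiniteGrp.{u} → Prop}
    (G : BisetCatOn k 𝒯) : FiniteGrp.{u} := G.obj.grp

/-- The category `ℱ_{𝒯,k}` of `k`-linear functors from `k𝒯` to `k`-modules, a full subcategory of
the category of all functors. -/
abbrev BisetFunctor (k : Type v) [CommRing k] (𝒯 : FiniteGrp.{u} → Prop) :
    Type (max (u + 1) (v + 1)) :=
  ObjectProperty.FullSubcategory fun F : BisetCatOn k 𝒯 ⥤ ModuleCat.{max u v} k =>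
    F.Additive ∧ F.Linear k

namespace BisetFunctor

variable {k : Type v} [CommRing k] {𝒯 : FiniteGrp.{u} → Prop}

/-- A subfunctor of `F`: a family of submodules `L(H) ≤ F(H)` stable under all `F(α)`. -/
structure Subfunctor (F : BisetFunctor k 𝒯) where
  carrier : ∀ H : BisetCatOn k 𝒯, Submodule k (F.obj.obj H)
  map_mem : ∀ {G H : BisetCatOn k 𝒯} (α : G ⟶ H) (x : F.obj.obj G), x ∈ carrier G →
    F.obj.map α x ∈ carrier H

/-- An element of `F` is a pair `(R, v)` with `R ∈ 𝒯` and `v ∈ F(R)`. -/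
abbrev Element (F : BisetFunctor k 𝒯) : Type _ := Σ R : BisetCatOn k 𝒯, F.obj.obj R

/-- The subfunctor `⟨𝒢⟩` generated by a set of elements of `F`: the intersection of all the
subfunctors containing `𝒢`. -/
def generated (F : BisetFunctor k 𝒯) (𝒢 : Set F.Element) : F.Subfunctor where
  carrier H := ⨅ L ∈ {L : F.Subfunctor | ∀ g ∈ 𝒢, g.2 ∈ L.carrier g.1}, L.carrier H
  map_mem α x hx := by
    simp only [Submodule.mem_iInf] at hx ⊢
    exact fun L hL => L.map_mem α x (hx L hL)

/-- `F` is finitely generated if `⟨𝒢⟩ = F` for some finite set `𝒢` of elements of `F`. -/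
def IsFinitelyGenerated (F : BisetFunctor k 𝒯) : Prop :=
  ∃ 𝒢 : Set F.Element, 𝒢.Finite ∧ ∀ H, (F.generated 𝒢).carrier H = ⊤

/-- The submodule of `F(H)` spanned by the images of all `F(α)`, for `α ∈ kB(H, T)` with `T ∈ 𝒯`
and `|T| < |H|`. -/
def residueKer (F : BisetFunctor k 𝒯) (H : BisetCatOn k 𝒯) : Submodule k (F.obj.obj H) :=
  ⨆ (T : BisetCatOn k 𝒯) (_ : Nat.card T.group < Nat.card H.group) (α : T ⟶ H),
    LinearMap.range (F.obj.map α).hom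

/-- The residue (Brauer quotient) of `F` at `H`. -/
abbrev Residue (F : BisetFunctor k 𝒯) (H : BisetCatOn k 𝒯) : Type (max u v) :=
  F.obj.obj H ⧸ F.residueKer H

/-- The representable functor `kB_R = Hom(R, -)`, whose value at `H` is `kB(H, R)`. -/
noncomputable def representable (R : BisetCatOn k 𝒯) : BisetFunctor k 𝒯 where
  obj := (linearCoyoneda k (BisetCatOn k 𝒯)).obj (Opposite.op R)
  property := ⟨inferInstance, ⟨fun f r => by
    ext g
    exact Linear.comp_smul _ _ _ g r f⟩⟩

/-- The direct sum of a family of biset functors, computed pointwise. -/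
noncomputable def directSum {ι : Type} (P : ι → BisetFunctor k 𝒯) : BisetFunctor k 𝒯 where
  obj :=
    { obj := fun H => ModuleCat.of k (⨁ i, (P i).obj.obj H)
      map := fun α => ModuleCat.ofHom (DirectSum.lmap fun i => ((P i).obj.map α).hom)
      map_id := fun H => ModuleCat.hom_ext (LinearMap.ext fun x => DFinsupp.ext fun i =>
        congrArg (fun φ => φ.hom (x i)) ((P i).obj.map_id H))
      map_comp := fun α β => ModuleCat.hom_ext (LinearMap.ext fun x => DFinsupp.ext fun i =>
        congrArg (fun φ => φ.hom (x i)) ((P i).obj.map_comp α β)) }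
  property :=
    ⟨⟨fun {_ _ α β} => ModuleCat.hom_ext (LinearMap.ext fun x => DFinsupp.ext fun i =>
        congrArg (fun φ => φ.hom (x i)) ((P i).property.1.map_add (f := α) (g := β)))⟩,
      ⟨fun α r => ModuleCat.hom_ext (LinearMap.ext fun x => DFinsupp.ext fun i =>
        congrArg (fun φ => φ.hom (x i)) ((P i).property.2.map_smul α r))⟩⟩

end BisetFunctor

/-! ### Finite generation of the Burnside group -/

namespace BurnsideGroup

variable {A : Type u} [Group A]

theorem of_eq_zero_of_isEmpty (X : Type*) [Finite X] [MulAction A X] [IsEmpty X] :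
    of A X = 0 := by
  have h : of A (X ⊕ X) = of A X :=
    of_eq ⟨Equiv.equivOfIsEmpty _ _, fun _ x => isEmptyElim x⟩
  rw [of_sum] at h
  simpa using h

/-- An `A`-set is the disjoint union of an orbit and the complement of that orbit. -/
theorem exists_iso_quotient_sum (X : Type*) [MulAction A X] (x : X) :
    ∃ Y : SubMulAction A X, x ∉ Y ∧
      GSetIso A X ((A ⧸ MulAction.stabilizer A x) ⊕ Y) := by
  classical
  let Y : SubMulAction A X :=
    { carrier := (MulAction.orbit A x)ᶜ
      smul_mem' := fun a y hy h => hy (by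
        rwa [← MulAction.orbit_eq_iff, MulAction.orbit_smul, MulAction.orbit_eq_iff] at h) }
  refine ⟨Y, fun h => h (MulAction.mem_orbit_self x), GSetIso.symm ?_⟩
  refine ⟨(Equiv.sumCongr (MulAction.orbitEquivQuotientStabilizer A x).symm (Equiv.refl _)).trans
    (Equiv.Set.sumCompl (MulAction.orbit A x)), ?_⟩
  rintro a (q | y)
  · induction q using QuotientGroup.induction_on with
    | H g =>
      change ((MulAction.orbitEquivQuotientStabilizer A x).symm ((a * g : A) : A ⧸ _) : X) =
        a • ((MulAction.orbitEquivQuotientStabilizer A x).symm (g : A ⧸ _) : X)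
      rw [MulAction.orbitEquivQuotientStabilizer_symm_apply,
        MulAction.orbitEquivQuotientStabilizer_symm_apply, mul_smul]
  · rfl

theorem of_mem_closure_quotient [Finite A] (X : Type*) [Finite X] [MulAction A X] :
    of A X ∈ AddSubgroup.closure (Set.range fun S : Subgroup A => of A (A ⧸ S)) := by
  induction hn : Nat.card X using Nat.strong_induction_on generalizing X with
  | _ n ih =>
  rcases isEmpty_or_nonempty X with hX | ⟨⟨x⟩⟩
  · rw [of_eq_zero_of_isEmpty]
    exact zero_mem _
  · obtain ⟨Y, hx, hY⟩ := exists_iso_quotient_sum (A := A) X x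
    have : Finite Y := inferInstanceAs (Finite {y // y ∈ Y})
    rw [of_eq hY, of_sum]
    refine add_mem (AddSubgroup.subset_closure ⟨_, rfl⟩) (ih _ ?_ Y rfl)
    rw [← hn]
    exact Finite.card_subtype_lt (p := fun y => y ∈ Y) hx

theorem closure_quotient_eq_top [Finite A] :
    AddSubgroup.closure (Set.range fun S : Subgroup A => of A (A ⧸ S)) = ⊤ := by
  refine (AddSubgroup.eq_top_iff' _).2 fun x => ?_
  induction x using BurnsideGroup.induction with
  | of X => exact of_mem_closure_quotient _
  | add x y hx hy => exact add_mem hx hy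
  | neg x hx => exact neg_mem hx

instance [Finite A] : Module.Finite ℤ (BurnsideGroup A) := by
  have : AddGroup.FG (BurnsideGroup A) :=
    ⟨(AddSubgroup.fg_iff _).2 ⟨_, closure_quotient_eq_top, Set.finite_range _⟩⟩
  exact Module.Finite.iff_addGroup_fg.2 this

end BurnsideGroup

/-! ### The biset attached to a group homomorphism -/

/-- For a homomorphism `φ : H →* G`, the set `G` as a `(G, H)`-biset, with `H` acting on the right
through `φ`. -/
@[ext]
structure HomBiset {H G : Type*} [Group H] [Group G] (φ : H →* G) where
  val : G

namespace HomBiset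

variable {H G : Type*} [Group H] [Group G]

instance (φ : H →* G) [Finite G] : Finite (HomBiset φ) :=
  Finite.of_injective HomBiset.val fun _ _ => HomBiset.ext

instance (φ : H →* G) : MulAction (G × Hᵐᵒᵖ) (HomBiset φ) where
  smul a x := ⟨a.1 * x.val * φ a.2.unop⟩
  one_smul x := HomBiset.ext (show 1 * x.val * φ 1 = x.val by simp)
  mul_smul a b x := HomBiset.ext (show a.1 * b.1 * x.val * φ (b.2.unop * a.2.unop) =
    a.1 * (b.1 * x.val * φ b.2.unop) * φ a.2.unop by simp [mul_assoc])

@[simp]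
theorem smul_val (φ : H →* G) (a : G × Hᵐᵒᵖ) (x : HomBiset φ) :
    (a • x).val = a.1 * x.val * φ a.2.unop := rfl

/-- The bisets attached to two homomorphisms whose composite is the identity compose to the
identity biset. -/
theorem iso_of_comp_eq_id (φ : H →* G) (ψ : G →* H) (h : φ.comp ψ = MonoidHom.id G) :
    GSetIso (G × Gᵐᵒᵖ) (BisetTensor G H G (HomBiset φ) (HomBiset ψ)) (IdBiset G) := by
  have h' : ∀ g, φ (ψ g) = g := DFunLike.congr_fun h
  refine ⟨⟨BisetTensor.lift (fun x y => ⟨x.val * φ y.val⟩) ?_,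
    fun g => BisetTensor.mk G H G ⟨g.val⟩ ⟨1⟩, ?_, ?_⟩, ?_⟩
  · intro x a y
    ext
    simp [mul_assoc]
  · refine BisetTensor.ind fun x y => ?_
    refine Eq.trans ?_ ((BisetTensor.mk_balanced G H G x y.val (⟨1⟩ : HomBiset ψ)).trans ?_)
    · congr 1
      ext
      change x.val * φ y.val = 1 * x.val * φ y.val
      rw [one_mul]
    · congr 1
      ext
      simp
  · intro g
    ext
    change g.val * φ 1 = g.val
    simp
  · intro a
    refine BisetTensor.ind fun x y => ?_
    ext
    change (((a.1, 1) : G × Hᵐᵒᵖ) • x).val * φ (((1, a.2) : H × Gᵐᵒᵖ) • y).val =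
      a.1 * (x.val * φ y.val) * a.2.unop
    simp [mul_assoc, h']

end HomBiset

namespace BisetCatOn

variable {k : Type v} [CommRing k] {𝒯 : FiniteGrp.{u} → Prop}

instance (G H : BisetCatOn k 𝒯) : Module.Finite k (G ⟶ H) := by
  have : Finite (G.group : Type u)ᵐᵒᵖ := Finite.of_equiv _ opEquiv
  have : Module.Finite ℤ (BisetBurnside H.group G.group) := inferInstance
  have : Module.Finite k (LinBisetBurnside k H.group G.group) := inferInstance
  exact Module.Finite.equiv
    ({ toFun := fun α => ⟨α⟩
       invFun := fun α => α.hom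
       left_inv := fun _ => rfl
       right_inv := fun _ => rfl
       map_add' := fun _ _ => rfl
       map_smul' := fun _ _ => rfl } : LinBisetBurnside k H.group G.group ≃ₗ[k] (G ⟶ H))

/-- The morphism of `k𝒯` given by the biset of a group homomorphism. -/
noncomputable def ofHom {G H : BisetCatOn k 𝒯} (φ : G.group →* H.group) : G ⟶ H :=
  ⟨(1 ⊗ₜ BurnsideGroup.of _ (HomBiset φ) : LinBisetBurnside k H.group G.group)⟩

theorem ofHom_comp_eq_id {G H : BisetCatOn k 𝒯} (φ : G.group →* H.group) (ψ : H.group →* G.group)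
    (h : φ.comp ψ = MonoidHom.id _) : ofHom ψ ≫ ofHom φ = 𝟙 H := by
  apply ObjectProperty.hom_ext
  change linBisetComp k _ _ _ (1 ⊗ₜ _) (1 ⊗ₜ _) = (1 ⊗ₜ _ : LinBisetBurnside k _ _)
  rw [linBisetComp_tmul, bisetComp_of, mul_one, bisetId,
    BurnsideGroup.of_eq (HomBiset.iso_of_comp_eq_id φ ψ h)]

/-- Up to isomorphism there are finitely many groups of order at most `n`. -/
theorem exists_finite_representatives (k : Type v) [CommRing k] (𝒯 : FiniteGrp.{u} → Prop) (n : ℕ) :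
    ∃ S : Set (BisetCatOn k 𝒯), S.Finite ∧ ∀ H : BisetCatOn k 𝒯, Nat.card H.group ≤ n →
      ∃ G ∈ S, Nonempty (G.group ≃* H.group) := by
  let T := {H : BisetCatOn k 𝒯 // Nat.card H.group ≤ n}
  let f : T → Σ m : Fin (n + 1), Fin m → Fin m → Fin m := fun H =>
    ⟨⟨Nat.card H.1.group, Nat.lt_succ_of_le H.2⟩, fun a b =>
      Finite.equivFin H.1.group ((Finite.equivFin H.1.group).symm a *
        (Finite.equivFin H.1.group).symm b)⟩
  have key : ∀ G H : T, f G = f H → Nonempty (G.1.group ≃* H.1.group) := by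
    intro G H h
    obtain ⟨m, μ, hG⟩ : ∃ m μ, f G = ⟨m, μ⟩ := ⟨_, _, rfl⟩
    have transfer : ∀ K : T, f K = ⟨m, μ⟩ →
        ∃ e : K.1.group ≃ Fin m, ∀ a b, e (a * b) = μ (e a) (e b) := by
      intro K hK
      cases hK
      refine ⟨Finite.equivFin K.1.group, fun a b => ?_⟩
      simp
    obtain ⟨e, he⟩ := transfer G hG
    obtain ⟨e', he'⟩ := transfer H (h ▸ hG)
    exact ⟨⟨e.trans e'.symm, fun a b => by
      simp only [Equiv.toFun_as_coe, Equiv.trans_apply]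
      rw [Equiv.symm_apply_eq, he, he', Equiv.apply_symm_apply, Equiv.apply_symm_apply]⟩⟩
  refine ⟨Set.range fun c : Set.range f => c.2.choose.1, Set.finite_range _, fun H hH => ?_⟩
  let c : Set.range f := ⟨f ⟨H, hH⟩, _, rfl⟩
  exact ⟨_, ⟨c, rfl⟩, key _ ⟨H, hH⟩ c.2.choose_spec⟩

end BisetCatOn

/-! ### Images, cokernels and the Yoneda map -/

namespace BisetFunctor

variable {k : Type v} [CommRing k] {𝒯 : FiniteGrp.{u} → Prop}

theorem generated_le {F : BisetFunctor k 𝒯} {𝒢 : Set F.Element} {L : F.Subfunctor}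
    (hL : ∀ g ∈ 𝒢, g.2 ∈ L.carrier g.1) (H : BisetCatOn k 𝒯) :
    (F.generated 𝒢).carrier H ≤ L.carrier H :=
  iInf₂_le L hL

theorem mem_generated {F : BisetFunctor k 𝒯} {𝒢 : Set F.Element} {g : F.Element} (hg : g ∈ 𝒢) :
    g.2 ∈ (F.generated 𝒢).carrier g.1 := by
  simp only [generated, Submodule.mem_iInf]
  exact fun L hL => hL g hg

variable {E F : BisetFunctor k 𝒯}

/-- The component at `H` of a morphism of biset functors, as a linear map. -/
def component (π : E ⟶ F) (H : BisetCatOn k 𝒯) : E.obj.obj H →ₗ[k] F.obj.obj H :=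
  (π.hom.app H).hom

theorem component_map (π : E ⟶ F) {G H : BisetCatOn k 𝒯} (α : G ⟶ H) (x : E.obj.obj G) :
    component π H (E.obj.map α x) = F.obj.map α (component π G x) :=
  NatTrans.naturality_apply π.hom α x

/-- The image of a morphism of biset functors. -/
def image (π : E ⟶ F) : F.Subfunctor where
  carrier H := LinearMap.range (component π H)
  map_mem := by
    rintro G H α _ ⟨x, rfl⟩
    exact ⟨E.obj.map α x, component_map π α x⟩

/-- The quotient of a biset functor by a subfunctor. -/
def Subfunctor.quotient (L : F.Subfunctor) : BisetFunctor k 𝒯 where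
  obj :=
    { obj := fun H => ModuleCat.of k (F.obj.obj H ⧸ L.carrier H)
      map := fun {G H} α => ModuleCat.ofHom ((L.carrier G).mapQ (L.carrier H) (F.obj.map α).hom
        fun x hx => L.map_mem α x hx)
      map_id := fun H => ModuleCat.hom_ext (Submodule.linearMap_qext _ (LinearMap.ext fun x => by
        simp))
      map_comp := fun α β => ModuleCat.hom_ext (Submodule.linearMap_qext _
        (LinearMap.ext fun x => by simp)) }
  property := by
    have := F.property.1
    have := F.property.2
    exact ⟨⟨fun {_ _ α β} => ModuleCat.hom_ext (Submodule.linearMap_qext _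
      (LinearMap.ext fun x => by simp [F.obj.map_add]))⟩,
      ⟨fun α r => ModuleCat.hom_ext (Submodule.linearMap_qext _
        (LinearMap.ext fun x => by simp [F.obj.map_smul]))⟩⟩

/-- The projection of a biset functor onto its quotient by a subfunctor. -/
def Subfunctor.projection (L : F.Subfunctor) : F ⟶ L.quotient :=
  ⟨{ app := fun H => ModuleCat.ofHom (L.carrier H).mkQ
     naturality := fun _ _ _ => rfl }⟩

/-- The zero morphism from a biset functor to its quotient by a subfunctor. -/
def Subfunctor.zeroProjection (L : F.Subfunctor) : F ⟶ L.quotient :=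
  ⟨{ app := fun _ => ModuleCat.ofHom 0
     naturality := fun _ _ α => ModuleCat.hom_ext (LinearMap.ext fun _ =>
      (map_zero (L.quotient.obj.map α).hom).symm) }⟩

theorem epi_iff_surjective (π : E ⟶ F) :
    Epi π ↔ ∀ H, Function.Surjective (component π H) := by
  constructor
  · intro hπ H
    have h : (image π).projection = (image π).zeroProjection := by
      rw [← cancel_epi π]
      apply ObjectProperty.hom_ext
      ext G x
      exact (Submodule.Quotient.mk_eq_zero _).2 ⟨x, rfl⟩
    intro y
    have hy : component (image π).projection H y = component (image π).zeroProjection H y := by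
      rw [h]
    exact (Submodule.Quotient.mk_eq_zero _).1 hy
  · intro h
    refine ⟨fun {Z} f g hfg => ?_⟩
    apply ObjectProperty.hom_ext
    ext H y
    obtain ⟨x, rfl⟩ := h H y
    exact DFunLike.congr_fun (congrArg (fun φ => component φ H) hfg) x

/-- The evaluation `α ↦ F(α)(v)` at an element `v` of `F(R)`. -/
def yonedaMap (F : BisetFunctor k 𝒯) {R : BisetCatOn k 𝒯} (v : F.obj.obj R)
    (H : BisetCatOn k 𝒯) : (R ⟶ H) →ₗ[k] F.obj.obj H where
  toFun α := F.obj.map α v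
  map_add' α β := by
    have := F.property.1
    simp [F.obj.map_add]
  map_smul' r α := by
    have := F.property.2
    simp [F.obj.map_smul]

/-- The element of a direct sum of representable functors given by a morphism `α : R i ⟶ H`. -/
noncomputable def directSumOf {m : ℕ} (R : Fin m → BisetCatOn k 𝒯) (H : BisetCatOn k 𝒯) (i : Fin m)
    (α : R i ⟶ H) : (directSum fun i => representable (R i)).obj.obj H :=
  DirectSum.lof k (Fin m) (fun i => (R i ⟶ H)) i α

theorem map_directSumOf {m : ℕ} (R : Fin m → BisetCatOn k 𝒯) {G H : BisetCatOn k 𝒯} (i : Fin m)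
    (α : R i ⟶ G) (β : G ⟶ H) :
    (directSum fun i => representable (R i)).obj.map β (directSumOf R G i α) =
      directSumOf R H i (α ≫ β) :=
  DirectSum.lmap_lof (R := k) (fun i => ((representable (R i)).obj.map β).hom) i α

theorem directSum_induction {m : ℕ} {R : Fin m → BisetCatOn k 𝒯} {H : BisetCatOn k 𝒯}
    {p : (directSum fun i => representable (R i)).obj.obj H → Prop} (zero : p 0)
    (of : ∀ i α, p (directSumOf R H i α)) (add : ∀ x y, p x → p y → p (x + y)) (x) : p x :=
  DirectSum.induction_on x zero of add

/-- The morphism from a direct sum of representable functors given by elements of `F`. -/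
noncomputable def ofElements (F : BisetFunctor k 𝒯) {m : ℕ} (R : Fin m → BisetCatOn k 𝒯)
    (v : ∀ i, F.obj.obj (R i)) : directSum (fun i => representable (R i)) ⟶ F :=
  ⟨{ app := fun H => ModuleCat.ofHom (DirectSum.toModule k (Fin m) (F.obj.obj H)
      fun i => F.yonedaMap (v i) H)
     naturality := fun G H α => by
      have key : ∀ {H : BisetCatOn k 𝒯} (i : Fin m) (β : R i ⟶ H),
          DirectSum.toModule k (Fin m) (F.obj.obj H) (fun i => F.yonedaMap (v i) H)
            (directSumOf R H i β) = F.obj.map β (v i) :=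
        fun i β => DirectSum.toModule_lof k (φ := fun i => F.yonedaMap (v i) _) i β
      refine ModuleCat.hom_ext (LinearMap.ext fun x => ?_)
      induction x using directSum_induction with
      | zero => rw [map_zero, map_zero]
      | add x y hx hy => rw [map_add, map_add, hx, hy]
      | of i β =>
        refine (congrArg (DirectSum.toModule k (Fin m) (F.obj.obj H) fun i => F.yonedaMap (v i) H)
          (map_directSumOf R i β α)).trans ((key i (β ≫ α)).trans ?_)
        refine Eq.trans ?_ (congrArg (F.obj.map α) (key i β).symm)
        exact ConcreteCategory.congr_hom (F.obj.map_comp β α) (v i) }⟩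

theorem component_ofElements (F : BisetFunctor k 𝒯) {m : ℕ} (R : Fin m → BisetCatOn k 𝒯)
    (v : ∀ i, F.obj.obj (R i)) {H : BisetCatOn k 𝒯} (i : Fin m) (α : R i ⟶ H) :
    component (F.ofElements R v) H (directSumOf R H i α) = F.obj.map α (v i) :=
  DirectSum.toModule_lof k (φ := fun i => F.yonedaMap (v i) H) i α

theorem exists_epi_of_isFinitelyGenerated (h : F.IsFinitelyGenerated) :
    ∃ (m : ℕ) (R : Fin m → BisetCatOn k 𝒯) (π : directSum (fun i => representable (R i)) ⟶ F),
      Epi π := by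
  obtain ⟨𝒢, h𝒢, hF⟩ := h
  have := h𝒢.to_subtype
  let e := Finite.equivFin 𝒢
  refine ⟨Nat.card 𝒢, fun i => (e.symm i).1.1, F.ofElements _ fun i => (e.symm i).1.2, ?_⟩
  rw [epi_iff_surjective]
  intro H
  rw [← LinearMap.range_eq_top, eq_top_iff, ← hF H]
  refine generated_le (L := image _) ?_ H
  intro g hg
  obtain ⟨i, hi⟩ := e.symm.surjective ⟨g, hg⟩
  obtain rfl : (e.symm i).1 = g := congrArg Subtype.val hi
  exact ⟨directSumOf _ _ i (𝟙 _), (component_ofElements ..).trans (by simp)⟩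

theorem map_mem_residueKer (F : BisetFunctor k 𝒯) {G H : BisetCatOn k 𝒯}
    (h : Nat.card G.group < Nat.card H.group) (α : G ⟶ H) (x : F.obj.obj G) :
    F.obj.map α x ∈ F.residueKer H :=
  Submodule.mem_iSup_of_mem G (Submodule.mem_iSup_of_mem h (Submodule.mem_iSup_of_mem α ⟨x, rfl⟩))

theorem subsingleton_residue_of_epi {m : ℕ} {R : Fin m → BisetCatOn k 𝒯}
    (π : directSum (fun i => representable (R i)) ⟶ F) [Epi π] (H : BisetCatOn k 𝒯)
    (hH : ∀ i, Nat.card (R i).group < Nat.card H.group) : Subsingleton (F.Residue H) := by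
  rw [Submodule.Quotient.subsingleton_iff, eq_top_iff,
    ← LinearMap.range_eq_top.2 ((epi_iff_surjective π).1 ‹_› H)]
  rintro _ ⟨x, rfl⟩
  induction x using directSum_induction with
  | zero =>
    rw [map_zero]
    exact zero_mem _
  | of i α =>
    have h : component π H (directSumOf R H i α) =
        F.obj.map α (component π (R i) (directSumOf R (R i) i (𝟙 _))) := by
      rw [← component_map, map_directSumOf, Category.id_comp]
    exact (congrArg (· ∈ F.residueKer H) h).mpr (map_mem_residueKer F (hH i) α _)
  | add x y hx hy =>
    rw [map_add]
    exact add_mem hx hy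

end BisetFunctor

/-! ### Finite generation and residues -/

/-- A finitely generated quotient is generated by the images of finitely many elements. -/
theorem Submodule.exists_finite_span_sup_eq_top {k M : Type*} [Ring k] [AddCommGroup M]
    [Module k M] (N : Submodule k M) [Module.Finite k (M ⧸ N)] :
    ∃ s : Set M, s.Finite ∧ N ⊔ Submodule.span k s = ⊤ := by
  obtain ⟨t, ht⟩ := Module.Finite.fg_top (R := k) (M := M ⧸ N)
  refine ⟨Function.surjInv N.mkQ_surjective '' (t : Set (M ⧸ N)), t.finite_toSet.image _, ?_⟩
  rw [← Submodule.comap_map_mkQ, Submodule.map_span, Set.image_image]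
  simp only [Function.surjInv_eq, Set.image_id', ht, Submodule.comap_top]

namespace BisetFunctor

variable {k : Type v} [CommRing k] {𝒯 : FiniteGrp.{u} → Prop} {F : BisetFunctor k 𝒯}

theorem finite_residue_of_epi {m : ℕ} {R : Fin m → BisetCatOn k 𝒯}
    (π : directSum (fun i => representable (R i)) ⟶ F) [Epi π] (H : BisetCatOn k 𝒯) :
    Module.Finite k (F.Residue H) := by
  have : Module.Finite k ((directSum fun i => representable (R i)).obj.obj H) :=
    inferInstanceAs (Module.Finite k (Π₀ i, (R i ⟶ H)))
  have := Module.Finite.of_surjective _ ((epi_iff_surjective π).1 ‹_› H)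
  infer_instance

namespace Subfunctor

theorem residueKer_le (L : F.Subfunctor) (H : BisetCatOn k 𝒯)
    (h : ∀ T : BisetCatOn k 𝒯, Nat.card T.group < Nat.card H.group → L.carrier T = ⊤) :
    F.residueKer H ≤ L.carrier H := by
  refine iSup_le fun T => iSup_le fun hT => iSup_le fun α => ?_
  rintro _ ⟨x, rfl⟩
  exact L.map_mem α x (by rw [h T hT]; trivial)

theorem carrier_eq_top_of_mulEquiv (L : F.Subfunctor) {G H : BisetCatOn k 𝒯}
    (e : G.group ≃* H.group) (h : L.carrier G = ⊤) : L.carrier H = ⊤ := by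
  refine (Submodule.eq_top_iff').2 fun x => ?_
  have hx : F.obj.map (BisetCatOn.ofHom e.toMonoidHom)
      (F.obj.map (BisetCatOn.ofHom e.symm.toMonoidHom) x) = x := by
    rw [← ConcreteCategory.comp_apply, ← F.obj.map_comp, BisetCatOn.ofHom_comp_eq_id]
    · simp
    · ext; simp
  rw [← hx]
  exact L.map_mem _ _ (by rw [h]; trivial)

end Subfunctor

theorem isFinitelyGenerated_of_residue (hfin : ∀ H : BisetCatOn k 𝒯, Module.Finite k (F.Residue H))
    (n : ℕ) (hn : ∀ H : BisetCatOn k 𝒯, n < Nat.card H.group → Subsingleton (F.Residue H)) :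
    F.IsFinitelyGenerated := by
  obtain ⟨S, hS, hrep⟩ := BisetCatOn.exists_finite_representatives k 𝒯 n
  choose s hs hspan using fun H => (F.residueKer H).exists_finite_span_sup_eq_top (k := k)
  let 𝒢 : Set F.Element := ⋃ G ∈ S, Sigma.mk G '' s G
  refine ⟨𝒢, hS.biUnion fun G _ => (hs G).image _, fun H => ?_⟩
  induction hc : Nat.card H.group using Nat.strong_induction_on generalizing H with
  | _ c ih =>
  subst hc
  have ih' : ∀ T : BisetCatOn k 𝒯, Nat.card T.group < Nat.card H.group →
      (F.generated 𝒢).carrier T = ⊤ := fun T hT => ih _ hT T rfl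
  by_cases hH : n < Nat.card H.group
  · have := hn H hH
    rw [eq_top_iff, ← Submodule.Quotient.subsingleton_iff.1 this]
    exact Subfunctor.residueKer_le _ H ih'
  · obtain ⟨G, hG, ⟨e⟩⟩ := hrep H (not_lt.1 hH)
    refine Subfunctor.carrier_eq_top_of_mulEquiv _ e (eq_top_iff.2 ?_)
    rw [← hspan G]
    refine sup_le (Subfunctor.residueKer_le _ G fun T hT => ih' T ?_) ?_
    · rwa [← Nat.card_congr e.toEquiv]
    · refine Submodule.span_le.2 fun x hx => ?_
      exact mem_generated (g := ⟨G, x⟩) (Set.mem_biUnion hG ⟨x, hx, rfl⟩)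

end BisetFunctor

theorem proposition6p2 (k : Type v) [CommRing k] (𝒯 : FiniteGrp.{u} → Prop)
    (h𝒯 : ClosedUnderSubquotients 𝒯) (F : BisetFunctor.{u, v} k 𝒯) :
    List.TFAE [
      F.IsFinitelyGenerated,
      ∃ (m : ℕ) (R : Fin m → BisetCatOn k 𝒯)
        (π : BisetFunctor.directSum (fun i => BisetFunctor.representable (R i)) ⟶ F), Epi π,
      (∀ H : BisetCatOn k 𝒯, Module.Finite k (F.Residue H)) ∧
        ∃ n : ℕ, ∀ H : BisetCatOn k 𝒯, n < Nat.card H.group → Subsingleton (F.Residue H)] := by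
  tfae_have 1 → 2 := BisetFunctor.exists_epi_of_isFinitelyGenerated
  tfae_have 2 → 3 := by
    rintro ⟨m, R, π, hπ⟩
    refine ⟨BisetFunctor.finite_residue_of_epi π, Finset.univ.sup fun i => Nat.card (R i).group,
      fun H hH => BisetFunctor.subsingleton_residue_of_epi π H fun i => lt_of_le_of_lt ?_ hH⟩
    exact Finset.le_sup (f := fun i => Nat.card (R i).group) (Finset.mem_univ i)
  tfae_have 3 → 1 := fun ⟨hfin, n, hn⟩ =>
    BisetFunctor.isFinitelyGenerated_of_residue hfin n hn
  tfae_finish
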